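/- Let $\mathcal X$ be a finite set with weights $w:\mathcal X\times\mathcal X\to[0,\infty)$ that are reversible with respect to a probability measure $\mu$ on $\mathcal X$ ($\mu(x)w(x,y)=\mu(y)w(y,x)$ for all $x,y$) and irreducible (any two vertices are joined by a path of oriented edges of positive weight). Let $\mathcal L(x,y)=w(x,y)$ for $x\neq y$ and $\mathcal L(x,x)=-\sum_{y\neq x}w(x,y)$. A spanning oriented forest $\phi$ is a set of oriented edges $(x,y)$ with $w(x,y)>0$, at most one leaving each vertex, without oriented cycle; its set of roots $\rho(\phi)$ is the set of vertices without outgoing edge. For $q>0$ let $\Phi$ be a random spanning oriented forest, defined on a probability space with probability $\mathbb P_q$ and expectation $\mathbb E_q$, with law $$\pi_q(\phi)=\frac{1}{Z(q)}\,q^{|\rho(\phi)|}\prod_{(x,y)\in\phi}w(x,y),\qquad Z(q)=\sum_{\phi}q^{|\rho(\phi)|}\prod_{(x,y)\in\phi}w(x,y).$$ Put $\bar{\mathcal X}=\rho(\Phi)$ and $\breve{\mathcal X}=\mathcal X\setminus\bar{\mathcal X}$. Let $$\bar{\mathcal L}=\mathcal L_{\bar{\mathcal X}\bar{\mathcal X}}-\mathcal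 L_{\bar{\mathcal X}\breve{\mathcal X}}(\mathcal L_{\breve{\mathcal X}\breve{\mathcal X}})^{-1}\mathcal L_{\breve{\mathcal X}\bar{\mathcal X}}$$ be the Schur complement in $\mathcal L$ of $\mathcal L_{\breve{\mathcal X}\breve{\mathcal X}}$ (which is invertible, since $\bar{\mathcal X}\neq\emptyset$; if $\breve{\mathcal X}=\emptyset$ then $\bar{\mathcal L}=\mathcal L$), and set $\bar w(\bar x)=-\bar{\mathcal L}(\bar x,\bar x)$ for $\bar x\in\bar{\mathcal X}$ and $\bar\alpha=\max_{\bar x\in\bar{\mathcal X}}\bar w(\bar x)$. Then, for every $m\in\{1,\dots,|\mathcal X|+1\}$, $$\mathbb E_q\big[\bar\alpha\,\mathbf 1_{|\bar{\mathcal X}|=m}\big]\;\ge\;\mathbb E_q\Big[\frac1{|\bar{\mathcal X}|}\sum_{\bar x\in\bar{\mathcal X}}\bar w(\bar x)\,\mathbf 1_{|\bar{\mathcal X}|=m}\Big]\;=\;q\,\frac{|\mathcal X|-m+1}{m}\,\mathbb P_q\big[|\bar{\mathcal X}|=m-1\big],$$ and $$\mathbb E_q[\bar\alpha]\;\ge\;\mathbb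 E_q\Big[\frac1{|\bar{\mathcal X}|}\sum_{\bar x\in\bar{\mathcal X}}\bar w(\bar x)\Big]\;=\;q\,\mathbb E_q\Big[\frac{|\breve{\mathcal X}|}{|\bar{\mathcal X}|+1}\Big].$$ -/

import Mathlib

open MeasureTheory ProbabilityTheory

noncomputable section

/-- A finite weighted graph on the vertex set `X`: nonnegative weights `w`, reversible with respect
to a probability measure `μ` on `X`, and irreducible (any vertex can be reached from any other
one through oriented edges of positive weight). -/
structure WeightedGraph (X : Type*) [Fintype X] where
  w : X → X → ℝ
  w_nonneg : ∀ x y, 0 ≤ w x y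
  μ : X → ℝ
  μ_nonneg : ∀ x, 0 ≤ μ x
  μ_sum : ∑ x, μ x = 1
  reversible : ∀ x y, μ x * w x y = μ y * w y x
  irreducible : ∀ x y, Relation.ReflTransGen (fun a b => 0 < w a b) x y

namespace WeightedGraph

variable {X : Type*} [Fintype X] [DecidableEq X]

/-- The jump rate `w(x) = ∑_{y ≠ x} w(x, y)`. -/
def rate (G : WeightedGraph X) (x : X) : ℝ := ∑ y ∈ Finset.univ.erase x, G.w x y

/-- The Markov generator (graph Laplacian): `w(x, y)` off the diagonal and `-w(x)` on it. -/
def generator (G : WeightedGraph X) : Matrix X X ℝ :=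
  Matrix.of fun x y => if x = y then - G.rate x else G.w x y

/-- The operator form of the generator: `L f (x) = ∑_y w(x, y) (f(y) - f(x))`. -/
theorem generator_mulVec (G : WeightedGraph X) (f : X → ℝ) (x : X) :
    (G.generator.mulVec f) x = ∑ y, G.w x y * (f y - f x) := by
  rw [Matrix.mulVec, dotProduct, ← Finset.add_sum_erase _ _ (Finset.mem_univ x),
    ← Finset.add_sum_erase (s := Finset.univ) (fun y => G.w x y * (f y - f x))
      (Finset.mem_univ x)]
  have h : ∑ y ∈ Finset.univ.erase x, G.generator x y * f y
      = ∑ y ∈ Finset.univ.erase x, G.w x y * f y :=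
    Finset.sum_congr rfl fun y hy => by
      simp [generator, (Finset.ne_of_mem_erase hy).symm]
  rw [h]
  simp only [generator, Matrix.of_apply, if_true, sub_self, mul_zero, zero_add, mul_sub,
    Finset.sum_sub_distrib, rate, ← Finset.sum_mul]
  ring

/-! ### Spanning oriented forests -/

/-- A spanning oriented forest of `G`, given by its set of oriented edges: every edge is an edge
of the graph, every vertex has at most one outgoing edge, and there is no oriented cycle. (So each
tree has exactly one vertex without outgoing edge, its root, and its edges point to the root.) -/
@[ext]
structure Forest (G : WeightedGraph X) where
  edges : Finset (X × X)
  pos : ∀ x y, (x, y) ∈ edges → 0 < G.w x y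
  out_unique : ∀ x y z, (x, y) ∈ edges → (x, z) ∈ edges → y = z
  acyclic : ∀ x, ¬ Relation.TransGen (fun a b => (a, b) ∈ edges) x x

namespace Forest

variable {G : WeightedGraph X}

instance : Fintype G.Forest :=
  Fintype.ofInjective Forest.edges fun _ _ h => Forest.ext h

instance : MeasurableSpace G.Forest := ⊤

/-- The set `ρ(φ)` of roots: the vertices without outgoing edge. -/
def roots (φ : G.Forest) : Finset X := Finset.univ.filter fun x => ∀ y, (x, y) ∉ φ.edges

/-- A forest has at least one root. -/
theorem roots_nonempty (φ : G.Forest) : φ.roots.Nonempty := by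
  have hX : Nonempty X := by
    by_contra h
    rw [not_nonempty_iff] at h
    simpa using G.μ_sum
  let r : X → X → Prop := fun a b => Relation.TransGen (fun a b => (a, b) ∈ φ.edges) b a
  have : IsTrans X r := ⟨fun a b c h1 h2 => h2.trans h1⟩
  have : Std.Irrefl r := ⟨fun a => φ.acyclic a⟩
  have wf : WellFounded r := Finite.wellFounded_of_trans_of_irrefl r
  obtain ⟨x, -, hx⟩ := wf.has_min Set.univ Set.univ_nonempty
  refine ⟨x, ?_⟩
  simp only [roots, Finset.mem_filter, Finset.mem_univ, true_and]
  intro y hy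
  exact hx y trivial (Relation.TransGen.single hy)

/-- The weight `w_q(φ) = q^{|ρ(φ)|} ∏_{(x,y) ∈ φ} w(x,y)`. -/
def weight (q : ℝ) (φ : G.Forest) : ℝ := q ^ φ.roots.card * ∏ e ∈ φ.edges, G.w e.1 e.2

theorem weight_pos {q : ℝ} (hq : 0 < q) (φ : G.Forest) : 0 < φ.weight q :=
  mul_pos (pow_pos hq _) (Finset.prod_pos fun e he => φ.pos e.1 e.2 he)

/-- The forest without edges, all of whose trees are single vertices. -/
def empty (G : WeightedGraph X) : G.Forest where
  edges := ∅
  pos := by simp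
  out_unique := by simp
  acyclic := by
    intro x h
    rcases Relation.TransGen.head'_iff.1 h with ⟨_, h, _⟩
    simp at h

end Forest

/-- The partition function `Z(q) = ∑_φ w_q(φ)`. -/
def partitionFunction (G : WeightedGraph X) (q : ℝ) : ℝ := ∑ φ : G.Forest, φ.weight q

theorem partitionFunction_pos (G : WeightedGraph X) {q : ℝ} (hq : 0 < q) :
    0 < G.partitionFunction q :=
  Finset.sum_pos (fun φ _ => φ.weight_pos hq) ⟨Forest.empty G, Finset.mem_univ _⟩

/-- The law `π_q(φ) = w_q(φ) / Z(q)` of the random forest. -/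
def forestLaw (G : WeightedGraph X) (q : ℝ) (hq : 0 < q) : PMF G.Forest :=
  PMF.ofFintype (fun φ => ENNReal.ofReal (φ.weight q / G.partitionFunction q)) (by
    rw [← ENNReal.ofReal_sum_of_nonneg
      fun φ _ => (div_pos (φ.weight_pos hq) (G.partitionFunction_pos hq)).le, ← Finset.sum_div]
    change ENNReal.ofReal (G.partitionFunction q / G.partitionFunction q) = 1
    rw [div_self (G.partitionFunction_pos hq).ne', ENNReal.ofReal_one])

/-! ### The generator on a subset of vertices -/

/-- For a nonempty set `R` of vertices, the block of the generator indexed by the complement of `R`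
is invertible, so that its Schur complement makes sense. -/
theorem isUnit_generator_toBlock (G : WeightedGraph X) {R : Finset X} (hR : R.Nonempty) :
    IsUnit (G.generator.toBlock (· ∉ R) (· ∉ R)) := by
  have key : ∀ v : {x // x ∉ R} → ℝ,
      (G.generator.toBlock (· ∉ R) (· ∉ R)).mulVec v = 0 → ∀ x, v x ≤ 0 := by
    intro v hv
    let f : X → ℝ := fun x => if h : x ∉ R then v ⟨x, h⟩ else 0
    have hL : ∀ x, x ∉ R → ∑ y, G.w x y * (f y - f x) = 0 := by
      intro x hx
      rw [← generator_mulVec]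
      have h1 := congrFun hv ⟨x, hx⟩
      simp only [Matrix.mulVec, dotProduct, Matrix.toBlock_apply, Pi.zero_apply] at h1 ⊢
      rw [← h1, ← Fintype.sum_subtype_add_sum_subtype (fun y => y ∉ R)]
      have h2 : ∑ y : {y // ¬ y ∉ R}, G.generator x y * f y = 0 :=
        Finset.sum_eq_zero fun y _ => by simp [f, not_not.1 y.2]
      rw [h2, add_zero]
      exact Finset.sum_congr rfl fun y _ => by simp [f, y.2]
    obtain ⟨r, hr⟩ := hR
    obtain ⟨x0, -, hx0⟩ := Finset.exists_max_image Finset.univ f ⟨r, Finset.mem_univ r⟩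
    have hmax : f x0 ≤ 0 := by
      by_contra hpos
      push Not at hpos
      have hpath : ∀ z, Relation.ReflTransGen (fun a b => 0 < G.w a b) x0 z → f z = f x0 := by
        intro z hz
        induction hz with
        | refl => rfl
        | @tail b c _ hbc ih =>
          have hb : b ∉ R := by
            intro hb
            have : f b = 0 := by simp [f, hb]
            linarith
          have hle : ∀ y ∈ Finset.univ, G.w b y * (f y - f b) ≤ 0 := fun y hy =>
            mul_nonpos_of_nonneg_of_nonpos (G.w_nonneg b y) (by linarith [hx0 y hy])
          have h0 := (Finset.sum_eq_zero_iff_of_nonpos hle).1 (hL b hb) c (Finset.mem_univ c)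
          rcases mul_eq_zero.1 h0 with h | h <;> linarith
      have h1 := hpath r (G.irreducible x0 r)
      have h2 : f r = 0 := by simp [f, hr]
      linarith
    intro x
    have h1 := hx0 x.1 (Finset.mem_univ _)
    have h2 : f x.1 = v x := by simp [f, x.2]
    linarith
  rw [Matrix.isUnit_iff_isUnit_det, isUnit_iff_ne_zero]
  intro hdet
  obtain ⟨v, hv0, hv⟩ := Matrix.exists_mulVec_eq_zero_iff.2 hdet
  refine hv0 (funext fun x => le_antisymm (key v hv x) ?_)
  have := key (-v) (by rw [Matrix.mulVec_neg, hv, neg_zero]) x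
  simpa using this

/-- The Schur complement in the generator `L` of its block indexed by `X \ R`:
`L_{R,R} - L_{R,X\R} (L_{X\R,X\R})⁻¹ L_{X\R,R}`. -/
def reducedGenerator (G : WeightedGraph X) (R : Finset X) : Matrix R R ℝ :=
  G.generator.toBlock (· ∈ R) (· ∈ R)
    - G.generator.toBlock (· ∈ R) (· ∉ R) * (G.generator.toBlock (· ∉ R) (· ∉ R))⁻¹
      * G.generator.toBlock (· ∉ R) (· ∈ R)

/-- The jump rates of the reduced generator. -/
def reducedRate (G : WeightedGraph X) (R : Finset X) (x : R) : ℝ := - G.reducedGenerator R x x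

/-- The maximal jump rate of the reduced generator (the supremum is a maximum, `R` being finite,
for `R` nonempty). -/
def reducedMaxRate (G : WeightedGraph X) (R : Finset X) : ℝ := ⨆ x : R, G.reducedRate R x

/-- The average over `R` of the jump rates of the reduced generator. -/
def reducedMeanRate (G : WeightedGraph X) (R : Finset X) : ℝ :=
  1 / (R.card : ℝ) * ∑ x : R, G.reducedRate R x

end WeightedGraph

end

/-!
The argument rests on the quantity `F(R) = ∑ ∏_{e ∈ φ} w(e)`, the sum being over the forests `φ`
with root set exactly `R` (`WeightedGraph.forestSum`). The matrix-tree theorem for principal minors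
(`WeightedGraph.det_neg_generator_toBlock`) says that `F(R)` is the determinant of the block of `-L`
indexed by the complement of `R`. It is obtained by expanding this determinant along its rows: the
row of `x` is `∑_z w(x, z) (e_x - e_z)`, so the determinant is a sum over all maps
`g : X \ R → X` of `∏ w(x, g x)` times the determinant of the matrix with rows `e_x - e_{g x}`. The
latter is `1` if the orbits of `g` all end in `R`, since the matrix is then unitriangular, and `0`
if `g` has a cycle, since the indicator of the points that reach the cycle lies in the kernel.

The Schur complement formula for determinants then gives
`w̄(x) F(R) = F(R \ {x})` for `x ∈ R` (`WeightedGraph.reducedRate_mul_forestSum`). As the root set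
is `R` with probability `q ^ |R| F(R) / Z(q)`, the expectation of any function of `|R|` times the
mean reduced rate becomes a sum of `F(R \ {x})` over pairs `x ∈ R`, and regrouping it by
`S = R \ {x}`, which arises from `|X| - |S|` pairs, yields a sum over forests with one root fewer
(`WeightedGraph.sum_weight_mul_reducedMeanRate`). Both identities are special cases. The
inequalities hold pointwise, a mean being at most a maximum.
-/

namespace WeightedGraph

variable {X : Type*}

/-! ### The determinant attached to a partial map -/

/-- The oriented graph of a map `g` defined on the complement of `R`: its edges are the pairs
`(x, g x)` with `x ∉ R`. -/
def MapEdge {R : Finset X} (g : {x // x ∉ R} → X) (a b : X) : Prop := ∃ h : a ∉ R, g ⟨a, h⟩ = b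

variable [Fintype X] [DecidableEq X]

/-- The matrix indexed by the complement of `R` with rows `e_x - e_{g x}`, where `e_z` is read as
`0` for `z ∈ R`. -/
def mapMatrix {R : Finset X} (g : {x // x ∉ R} → X) : Matrix {x // x ∉ R} {x // x ∉ R} ℝ :=
  Matrix.of fun x y => (if x = y then 1 else 0) - if g x = y then 1 else 0

theorem det_mapMatrix_of_acyclic {R : Finset X} (g : {x // x ∉ R} → X)
    (hg : ∀ x, ¬ Relation.TransGen (MapEdge g) x x) : (mapMatrix g).det = 1 := by
  classical
  -- The number of points reachable from `x` strictly decreases along the edges.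
  let reach : X → Finset X := fun x => Finset.univ.filter (Relation.TransGen (MapEdge g) x)
  let b : {x // x ∉ R} → ℕᵒᵈ := fun x => OrderDual.toDual (reach x).card
  have hstep : ∀ x y : {x // x ∉ R}, g x = y → b x < b y := by
    intro x y hxy
    have he : MapEdge g x y := ⟨x.2, hxy⟩
    refine OrderDual.toDual_lt_toDual.2 (Finset.card_lt_card ?_)
    rw [Finset.ssubset_iff_of_subset]
    · exact ⟨y, by simpa [reach] using Relation.TransGen.single he, by simpa [reach] using hg y⟩
    · intro z hz
      simp only [reach, Finset.mem_filter, Finset.mem_univ, true_and] at hz ⊢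
      exact Relation.TransGen.head he hz
  have htri : (mapMatrix g).BlockTriangular b := by
    intro x y hxy
    have h1 : x ≠ y := by rintro rfl; exact lt_irrefl _ hxy
    have h2 : g x ≠ y := fun h => lt_asymm hxy (hstep x y h)
    simp [mapMatrix, h1, h2]
  rw [htri.det]
  refine Finset.prod_eq_one fun k _ => ?_
  have : (mapMatrix g).toSquareBlock b k = 1 := by
    ext x y
    have h2 : g x.1 ≠ y.1 := fun h => (hstep x.1 y.1 h).ne (x.2.trans y.2.symm)
    simp [Matrix.toSquareBlock_def, mapMatrix, h2, Matrix.one_apply, Subtype.ext_iff]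
  rw [this, Matrix.det_one]

theorem det_mapMatrix_of_cycle {R : Finset X} (g : {x // x ∉ R} → X) {x : X}
    (hx : Relation.TransGen (MapEdge g) x x) : (mapMatrix g).det = 0 := by
  classical
  have hxR : x ∉ R := by
    obtain ⟨_, ⟨h, _⟩, _⟩ := Relation.TransGen.head'_iff.1 hx
    exact h
  let u : X → ℝ := fun y => if Relation.ReflTransGen (MapEdge g) y x then 1 else 0
  -- A point outside `R` reaches the cycle through `x` if and only if its image does.
  have hu : ∀ y : {x // x ∉ R}, u y = u (g y) := by
    intro y
    have : Relation.ReflTransGen (MapEdge g) y x ↔ Relation.ReflTransGen (MapEdge g) (g y) x := by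
      refine ⟨fun h => ?_, fun h => Relation.ReflTransGen.head ⟨y.2, rfl⟩ h⟩
      have h' : Relation.TransGen (MapEdge g) y x := by
        rcases Relation.reflTransGen_iff_eq_or_transGen.1 h with h | h
        · rw [← h]; exact hx
        · exact h
      obtain ⟨z, ⟨hy, hz⟩, hzx⟩ := Relation.TransGen.head'_iff.1 h'
      rw [← hz] at hzx
      exact hzx
    simp only [u, this]
  have huR : ∀ y ∈ R, u y = 0 := by
    intro y hy
    refine if_neg fun h => ?_
    rcases Relation.ReflTransGen.cases_head h with h | ⟨_, ⟨h, _⟩, _⟩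
    · exact hxR (h ▸ hy)
    · exact h hy
  refine Matrix.exists_mulVec_eq_zero_iff.1 ⟨fun y => u y, fun h => ?_, ?_⟩
  · have := congrFun h ⟨x, hxR⟩
    simp [u, Relation.ReflTransGen.refl] at this
  · ext y
    have h1 : ∑ z : {x // x ∉ R}, (if g y = z then 1 else 0) * u z = u (g y) := by
      by_cases hR : g y ∈ R
      · rw [huR _ hR]
        refine Finset.sum_eq_zero fun z _ => ?_
        rw [if_neg fun h : g y = z => z.2 (h ▸ hR), zero_mul]
      · rw [Finset.sum_eq_single ⟨g y, hR⟩]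
        · simp
        · intro z _ hz
          rw [if_neg fun h => hz (Subtype.ext h.symm), zero_mul]
        · simp
    simp only [Matrix.mulVec, dotProduct, mapMatrix, Matrix.of_apply, sub_mul,
      Finset.sum_sub_distrib, h1, Pi.zero_apply]
    simp [hu y]

/-! ### The matrix-tree theorem for principal minors -/

namespace Forest

variable {G : WeightedGraph X}

/-- The end point of the edge leaving `x`, or `x` itself if `x` is a root. -/
noncomputable def next (φ : G.Forest) (x : X) : X :=
  open Classical in if h : ∃ y, (x, y) ∈ φ.edges then h.choose else x

theorem mem_edges_iff (φ : G.Forest) (x y : X) :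
    (x, y) ∈ φ.edges ↔ x ∉ φ.roots ∧ φ.next x = y := by
  by_cases h : ∃ y, (x, y) ∈ φ.edges
  · have hn : (x, φ.next x) ∈ φ.edges := by
      rw [next, dif_pos h]; exact h.choose_spec
    have hr : x ∉ φ.roots := by simpa [roots] using h
    exact ⟨fun hy => ⟨hr, φ.out_unique _ _ _ hn hy⟩, fun hy => hy.2 ▸ hn⟩
  · have hr : x ∈ φ.roots := by simpa [roots] using h
    exact ⟨fun hy => (h ⟨y, hy⟩).elim, fun hy => (hy.1 hr).elim⟩

theorem edges_eq_image (φ : G.Forest) :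
    φ.edges = Finset.univ.image fun x : {x // x ∉ φ.roots} => (x.1, φ.next x) := by
  ext ⟨x, y⟩
  simp [mem_edges_iff]

/-- The forest whose edges are the pairs `(x, g x)`, for an acyclic map `g` defined outside `R`. -/
def ofMap {R : Finset X} (g : {x // x ∉ R} → X) (hpos : ∀ x : {x // x ∉ R}, 0 < G.w x.1 (g x))
    (hg : ∀ x, ¬ Relation.TransGen (MapEdge g) x x) : G.Forest where
  edges := Finset.univ.image fun x => (x.1, g x)
  pos := by
    intro x y h
    simp only [Finset.mem_image, Finset.mem_univ, true_and, Prod.mk.injEq] at h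
    obtain ⟨z, rfl, rfl⟩ := h
    exact hpos z
  out_unique := by
    intro x y z hy hz
    simp only [Finset.mem_image, Finset.mem_univ, true_and, Prod.mk.injEq] at hy hz
    obtain ⟨a, rfl, rfl⟩ := hy
    obtain ⟨b, hb, rfl⟩ := hz
    rw [Subtype.ext hb]
  acyclic := by
    intro x h
    refine hg x (Relation.TransGen.mono (fun a b hab => ?_) _ _ h)
    simp only [Finset.mem_image, Finset.mem_univ, true_and, Prod.mk.injEq] at hab
    obtain ⟨z, rfl, rfl⟩ := hab
    exact ⟨z.2, rfl⟩

theorem roots_ofMap {R : Finset X} (g : {x // x ∉ R} → X) (hpos : ∀ x : {x // x ∉ R}, 0 < G.w x.1 (g x))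
    (hg : ∀ x, ¬ Relation.TransGen (MapEdge g) x x) : (ofMap g hpos hg).roots = R := by
  ext x
  simp [roots, ofMap]

end Forest

/-- The total weight, without powers of `q`, of the forests with root set `R`. -/
noncomputable def forestSum (G : WeightedGraph X) (R : Finset X) : ℝ :=
  ∑ φ : G.Forest with φ.roots = R, ∏ e ∈ φ.edges, G.w e.1 e.2

/-- Forests with root set `R` correspond to the acyclic maps `g : X \ R → X` with positive
weights. -/
theorem forestSum_eq_sum_maps (G : WeightedGraph X) (R : Finset X) :
    G.forestSum R = ∑ g : {x // x ∉ R} → X, (∏ x : {x // x ∉ R}, G.w x.1 (g x)) * (mapMatrix g).det := by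
  have hedge : ∀ φ : G.Forest, ∀ a b,
      MapEdge (fun x : {x // x ∉ φ.roots} => φ.next x) a b ↔ (a, b) ∈ φ.edges := by
    intro φ a b
    simp [MapEdge, φ.mem_edges_iff]
  refine Finset.sum_of_injOn (fun φ (x : {x // x ∉ R}) => φ.next x) ?_ ?_ ?_ ?_
  · intro φ hφ ψ hψ h
    simp only [Finset.coe_filter, Finset.mem_univ, true_and, Set.mem_ofPred_eq] at hφ hψ
    refine Forest.ext ?_
    ext ⟨x, y⟩
    rw [φ.mem_edges_iff, ψ.mem_edges_iff, hφ, hψ]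
    exact and_congr_right fun hx => by rw [show φ.next x = ψ.next x from congrFun h ⟨x, hx⟩]
  · intro φ _
    simp
  · intro g _ hgn
    by_cases hg : ∀ x, ¬ Relation.TransGen (MapEdge g) x x
    · by_cases hpos : ∀ x : {x // x ∉ R}, 0 < G.w x.1 (g x)
      · refine (hgn ⟨Forest.ofMap g hpos hg, by simp [Forest.roots_ofMap], ?_⟩).elim
        funext x
        have hx : (x.1, g x) ∈ (Forest.ofMap g hpos hg).edges := by simp [Forest.ofMap, x.2]
        exact ((Forest.mem_edges_iff _ _ _).1 hx).2
      · push Not at hpos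
        obtain ⟨x, hx⟩ := hpos
        rw [Finset.prod_eq_zero (Finset.mem_univ x) (le_antisymm hx (G.w_nonneg _ _)), zero_mul]
    · push Not at hg
      obtain ⟨x, hx⟩ := hg
      rw [det_mapMatrix_of_cycle g hx, mul_zero]
  · intro φ hφ
    obtain rfl := (Finset.mem_filter.1 hφ).2
    rw [det_mapMatrix_of_acyclic, mul_one, φ.edges_eq_image, Finset.prod_image]
    · intro x _ y _ h
      exact Subtype.ext (Prod.ext_iff.1 h).1
    · intro x h
      exact φ.acyclic x (Relation.TransGen.mono (fun a b => (hedge φ a b).1) _ _ h)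

/-- The matrix-tree theorem for principal minors. It includes the case `R = ∅`, in which
both sides vanish. -/
theorem det_neg_generator_toBlock (G : WeightedGraph X) (R : Finset X) :
    (-G.generator.toBlock (· ∉ R) (· ∉ R)).det = G.forestSum R := by
  have hrow : -G.generator.toBlock (· ∉ R) (· ∉ R) = Matrix.of fun x : {x // x ∉ R} =>
      ∑ z : X, G.w x z • fun y : {x // x ∉ R} =>
        ((if x = y then 1 else 0) - if z = y then 1 else 0 : ℝ) := by
    ext x y
    simp only [Matrix.neg_apply, Matrix.toBlock_apply, Matrix.of_apply, Finset.sum_apply,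
      Pi.smul_apply, smul_eq_mul, mul_sub, Finset.sum_sub_distrib]
    by_cases h : x = y
    · subst h
      rw [← Finset.sum_sub_distrib, ← Finset.add_sum_erase _ _ (Finset.mem_univ x.1)]
      simp [generator, rate]
    · simp [generator, h, Subtype.ext_iff.not.1 h]
  rw [hrow, forestSum_eq_sum_maps]
  refine (Matrix.detRowAlternating.toMultilinearMap.map_sum _).trans
    (Finset.sum_congr rfl fun g _ => ?_)
  exact Matrix.detRowAlternating.toMultilinearMap.map_smul_univ (fun x : {x // x ∉ R} => G.w x.1 (g x))
    (fun x y => ((if x = y then 1 else 0) - if g x = y then 1 else 0 : ℝ))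

/-! ### Reduced rates as ratios of forest sums -/

theorem reducedRate_mul_forestSum (G : WeightedGraph X) (R : Finset X) (x : R) :
    G.reducedRate R x * G.forestSum R = G.forestSum (R.erase x) := by
  set A := G.generator.toBlock (· ∉ R) (· ∉ R) with hA
  have hU : IsUnit A := G.isUnit_generator_toBlock ⟨x, x.2⟩
  have := hU.neg.invertible
  -- The complement of `R \ {x}` is that of `R` with `x` added.
  let f : {y // y ∉ R} ⊕ Unit → {y // y ∉ R.erase x} :=
    Sum.elim (fun y => ⟨y, fun h => y.2 (Finset.mem_of_mem_erase h)⟩)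
      (fun _ => ⟨x, Finset.notMem_erase _ _⟩)
  have hf : Function.Bijective f := by
    constructor
    · rintro (a | a) (b | b) h
      · exact congrArg Sum.inl (Subtype.ext (congrArg Subtype.val h :))
      · exact (a.2 ((congrArg Subtype.val h : a.1 = x) ▸ x.2)).elim
      · exact (b.2 ((congrArg Subtype.val h : x.1 = b) ▸ x.2)).elim
      · rfl
    · rintro ⟨y, hy⟩
      by_cases h : y ∈ R
      · refine ⟨Sum.inr (), Subtype.ext ?_⟩
        by_contra hne
        exact hy (Finset.mem_erase.2 ⟨fun e => hne e.symm, h⟩)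
      · exact ⟨Sum.inl ⟨y, h⟩, rfl⟩
  let B : Matrix {y // y ∉ R} Unit ℝ := Matrix.of fun y _ => G.generator y x
  let C : Matrix Unit {y // y ∉ R} ℝ := Matrix.of fun _ y => G.generator x y
  let D : Matrix Unit Unit ℝ := Matrix.of fun _ _ => G.generator x x
  have hblock : (-G.generator.toBlock (· ∉ R.erase x) (· ∉ R.erase x)).submatrix
      (Equiv.ofBijective f hf) (Equiv.ofBijective f hf) = Matrix.fromBlocks (-A) (-B) (-C) (-D) := by
    ext (i | i) (j | j) <;> rfl
  rw [← det_neg_generator_toBlock, ← det_neg_generator_toBlock,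
    ← Matrix.det_submatrix_equiv_self (Equiv.ofBijective f hf), hblock, Matrix.det_fromBlocks₁₁,
    mul_comm, ← hA]
  congr 1
  have hinv : ⅟(-A) = -A⁻¹ := by
    refine invOf_eq_right_inv ?_
    rw [neg_mul_neg, Matrix.mul_nonsing_inv _ ((Matrix.isUnit_iff_isUnit_det _).1 hU)]
  rw [Matrix.det_unique, hinv, reducedRate, reducedGenerator, ← hA]
  simp only [Matrix.neg_mul, Matrix.mul_neg, neg_neg, Matrix.sub_apply, Matrix.neg_apply, neg_sub,
    sub_neg_eq_add]
  simp only [Matrix.mul_apply, Matrix.toBlock_apply, B, C, D, Matrix.of_apply]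
  ring

/-! ### Sums over forests -/

theorem sum_weight_mul_roots (G : WeightedGraph X) (q : ℝ) (f : Finset X → ℝ) :
    ∑ φ : G.Forest, φ.weight q * f φ.roots = ∑ R, q ^ R.card * G.forestSum R * f R := by
  rw [← Finset.sum_fiberwise Finset.univ Forest.roots]
  refine Finset.sum_congr rfl fun R _ => ?_
  rw [forestSum, Finset.mul_sum, Finset.sum_mul]
  refine Finset.sum_congr rfl fun φ hφ => ?_
  rw [Forest.weight, (Finset.mem_filter.1 hφ).2]

theorem sum_sum_erase (k : Finset X → ℝ) :
    ∑ R : Finset X, ∑ x ∈ R, k (R.erase x) = ∑ S : Finset X, (Sᶜ.card : ℝ) * k S := by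
  simp_rw [← nsmul_eq_mul, ← Finset.sum_const, Finset.sum_sigma']
  refine Finset.sum_bij' (fun p _ => ⟨p.1.erase p.2, p.2⟩) (fun p _ => ⟨insert p.2 p.1, p.2⟩)
    ?_ ?_ ?_ ?_ ?_
  · simp
  · simp
  · rintro ⟨R, x⟩ h
    simp at h
    simp [Finset.insert_erase h]
  · rintro ⟨S, x⟩ h
    simp at h
    simp [Finset.erase_insert h]
  · simp

/-- Averages of the mean reduced rate against a function `h` of the number of roots. The weight
`h |R|` is moved to the root sets `S` obtained from `R` by deleting a point. -/
theorem sum_weight_mul_reducedMeanRate (G : WeightedGraph X) (q : ℝ) (h : ℕ → ℝ) :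
    ∑ φ : G.Forest, φ.weight q * (h φ.roots.card * G.reducedMeanRate φ.roots) =
      q * ∑ φ : G.Forest, φ.weight q *
        (h (φ.roots.card + 1) * ((φ.rootsᶜ.card : ℝ) / ((φ.roots.card : ℝ) + 1))) := by
  rw [G.sum_weight_mul_roots q fun R => h R.card * G.reducedMeanRate R,
    G.sum_weight_mul_roots q fun R => h (R.card + 1) * ((Rᶜ.card : ℝ) / ((R.card : ℝ) + 1))]
  let k : Finset X → ℝ := fun S =>
    q ^ (S.card + 1) * (h (S.card + 1) / ((S.card : ℝ) + 1)) * G.forestSum S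
  calc _ = ∑ R : Finset X, ∑ x ∈ R, k (R.erase x) := by
        refine Finset.sum_congr rfl fun R _ => ?_
        rw [reducedMeanRate, ← Finset.sum_coe_sort R, Finset.mul_sum, Finset.mul_sum,
          Finset.mul_sum]
        refine Finset.sum_congr rfl fun x _ => ?_
        have hc : (R.erase x).card + 1 = R.card := Finset.card_erase_add_one x.2
        have hc' : ((R.erase x).card : ℝ) + 1 = R.card := by exact_mod_cast hc
        simp only [k, hc, hc', ← reducedRate_mul_forestSum]
        ring
    _ = _ := by
        rw [sum_sum_erase, Finset.mul_sum]
        refine Finset.sum_congr rfl fun S _ => ?_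
        simp only [k]
        ring

/-! ### Expectations -/

theorem integral_comp_forest (G : WeightedGraph X) {q : ℝ} (hq : 0 < q) {Ω : Type*}
    [MeasurableSpace Ω] {P : Measure Ω} {Φ : Ω → G.Forest}
    (hΦ : HasLaw Φ (G.forestLaw q hq).toMeasure P) (f : G.Forest → ℝ) :
    ∫ ω, f (Φ ω) ∂P = (∑ φ : G.Forest, φ.weight q * f φ) / G.partitionFunction q := by
  have hm : Measurable f := fun _ _ => trivial
  have : MeasurableSingletonClass G.Forest := ⟨fun _ => trivial⟩
  refine (hΦ.integral_comp hm.aestronglyMeasurable).trans ?_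
  rw [PMF.integral_eq_sum, Finset.sum_div]
  refine Finset.sum_congr rfl fun φ _ => ?_
  rw [forestLaw, PMF.ofFintype_apply, ENNReal.toReal_ofReal
    (div_pos (φ.weight_pos hq) (G.partitionFunction_pos hq)).le, smul_eq_mul, div_mul_eq_mul_div]

theorem reducedMeanRate_le_reducedMaxRate (G : WeightedGraph X) {R : Finset X}
    (hR : R.Nonempty) : G.reducedMeanRate R ≤ G.reducedMaxRate R := by
  have hc : (0 : ℝ) < R.card := by exact_mod_cast hR.card_pos
  have hle : ∑ x : R, G.reducedRate R x ≤ ∑ _x : R, G.reducedMaxRate R :=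
    Finset.sum_le_sum fun x _ => le_ciSup (Set.finite_range (G.reducedRate R)).bddAbove x
  rw [reducedMeanRate, one_div, inv_mul_le_iff₀ hc]
  simpa using hle

end WeightedGraph

theorem mainTheorem7 {X : Type*} [Fintype X] [DecidableEq X] (G : WeightedGraph X)
    (q : ℝ) (hq : 0 < q)
    {Ω : Type*} [MeasurableSpace Ω] (P : Measure Ω) [IsProbabilityMeasure P]
    (Φ : Ω → G.Forest) (hΦ : HasLaw Φ (G.forestLaw q hq).toMeasure P) :
    (∀ m : ℕ, 1 ≤ m → m ≤ Fintype.card X + 1 →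
      (∫ ω, {ω | (Φ ω).roots.card = m}.indicator
            (fun ω => G.reducedMeanRate (Φ ω).roots) ω ∂P
          ≤ ∫ ω, {ω | (Φ ω).roots.card = m}.indicator
            (fun ω => G.reducedMaxRate (Φ ω).roots) ω ∂P) ∧
      (∫ ω, {ω | (Φ ω).roots.card = m}.indicator
            (fun ω => G.reducedMeanRate (Φ ω).roots) ω ∂P
          = q * (((Fintype.card X : ℝ) - m + 1) / m) *
              P.real {ω | (Φ ω).roots.card + 1 = m})) ∧
    (∫ ω, G.reducedMeanRate (Φ ω).roots ∂P ≤ ∫ ω, G.reducedMaxRate (Φ ω).roots ∂P) ∧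
    (∫ ω, G.reducedMeanRate (Φ ω).roots ∂P
      = q * ∫ ω, (((Φ ω).rootsᶜ.card : ℝ) / (((Φ ω).roots.card : ℝ) + 1)) ∂P) := by
  have hZ := G.partitionFunction_pos hq
  have hmono : ∀ f g : G.Forest → ℝ, (∀ φ, f φ ≤ g φ) →
      ∫ ω, f (Φ ω) ∂P ≤ ∫ ω, g (Φ ω) ∂P := by
    intro f g hfg
    rw [G.integral_comp_forest hq hΦ, G.integral_comp_forest hq hΦ]
    refine div_le_div_of_nonneg_right (Finset.sum_le_sum fun φ _ => ?_) hZ.le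
    exact mul_le_mul_of_nonneg_left (hfg φ) (φ.weight_pos hq).le
  have hle : ∀ φ : G.Forest, G.reducedMeanRate φ.roots ≤ G.reducedMaxRate φ.roots :=
    fun φ => G.reducedMeanRate_le_reducedMaxRate φ.roots_nonempty
  have hkey : ∀ h : ℕ → ℝ,
      ∫ ω, h (Φ ω).roots.card * G.reducedMeanRate (Φ ω).roots ∂P =
      q * ∫ ω, h ((Φ ω).roots.card + 1) *
        (((Φ ω).rootsᶜ.card : ℝ) / (((Φ ω).roots.card : ℝ) + 1)) ∂P := by
    intro h
    rw [G.integral_comp_forest hq hΦ fun φ => h φ.roots.card * G.reducedMeanRate φ.roots,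
      G.integral_comp_forest hq hΦ fun φ => h (φ.roots.card + 1) *
        ((φ.rootsᶜ.card : ℝ) / ((φ.roots.card : ℝ) + 1)),
      WeightedGraph.sum_weight_mul_reducedMeanRate, mul_div_assoc]
  refine ⟨fun m hm _ => ⟨?_, ?_⟩, hmono _ _ hle, ?_⟩
  · simp only [Set.indicator_apply, Set.mem_ofPred_eq]
    refine hmono (fun φ => if φ.roots.card = m then G.reducedMeanRate φ.roots else 0)
      (fun φ => if φ.roots.card = m then G.reducedMaxRate φ.roots else 0) fun φ => ?_
    split_ifs
    · exact hle φ
    · exact le_rfl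
  · have h1 := hkey fun k => if k = m then 1 else 0
    simp only [ite_mul, one_mul, zero_mul] at h1
    simp only [Set.indicator_apply, Set.mem_ofPred_eq]
    rw [h1, mul_assoc]
    congr 1
    -- The preimage is null-measurable only, `Φ` being almost everywhere measurable.
    have hnull : NullMeasurableSet {ω | (Φ ω).roots.card + 1 = m} P :=
      hΦ.aemeasurable.nullMeasurableSet_preimage
        (s := {φ : G.Forest | φ.roots.card + 1 = m}) trivial
    have hP : P.real {ω | (Φ ω).roots.card + 1 = m} =
        ∫ ω, {ω | (Φ ω).roots.card + 1 = m}.indicator 1 ω ∂P := by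
      rw [integral_indicator₀ hnull]
      simp
    rw [hP, ← integral_const_mul]
    refine integral_congr_ae (Filter.Eventually.of_forall fun ω => ?_)
    simp only [Set.indicator_apply, Set.mem_ofPred_eq, Pi.one_apply, mul_ite, mul_one, mul_zero]
    split_ifs with h
    · have h2 : ((Φ ω).roots.card : ℝ) + 1 = m := by exact_mod_cast h
      rw [Finset.card_compl, Nat.cast_sub (Finset.card_le_univ _), h2, ← h2]
      ring
    · rfl
  · simpa using hkey fun _ => 1
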